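/- For integers $w\ge 1$ and $N\ge 2w$, let $\mathsf{ApxCount}_{N,w}$ be the promise problem of deciding, for a nonempty set $S\subseteq[N]=\{1,\dots,N\}$, whether $|S|\ge 2w$ (yes) or $|S|\le w$ (no), promised that one of these holds. Let $\mathsf{AND}_2\circ\mathsf{ApxCount}_{N,w}$ be the promise problem whose instances are pairs $(S_0,S_1)$ of sets, each satisfying the promise of $\mathsf{ApxCount}_{N,w}$; such a pair is a yes instance if both $S_0$ and $S_1$ are yes instances, and a no instance otherwise. The membership oracle of $S\subseteq[N]$ is the unitary $\mathcal{O}_S|i\rangle|b\rangle=(1-2b\,x_i)|i\rangle|b\rangle$ for $i\in[N]$, $b\in\{0,1\}$, where $x_i=1$ if $i\in S$ and $x_i=0$ otherwise. A quantum query algorithm $Q$ making $T$ queries to the membership oracles of a pair $(S_0,S_1)$ works on registers $|k\rangle|i\rangle|b\rangle|z\rangle$, where $k\in\{0,1\}$, $i\in[N]$, $b\in\{0,1\}$ and $z$ labels the basis of a workspace of arbitrary finite dimension. It starts in a fixed basis state and applies $U_T\,\mathcal{O}\,U_{T-1}\,\mathcal{O}\cdots U_1\,\mathcal{O}\,U_0$,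 where the unitaries $U_j$ do not depend on the instance and a query $\mathcal{O}$ applies $\mathcal{O}_{S_k}$ to $|i\rangle|b\rangle$, controlled on $k$. It then measures in the computational basis and accepts if the outcome lies in a fixed set. Call $Q$ an $\mathsf{SBQP}$ algorithm for $\mathsf{AND}_2\circ\mathsf{ApxCount}_{N,w}$ if there is a real $\alpha>0$, independent of the instance but otherwise arbitrary (possibly exponentially small in $N$), such that $Q$ accepts every yes instance with probability at least $2\alpha$ and every no instance with probability at most $\alpha$. **Theorem.** There is a universal constant $c>0$ such that for all integers $w\ge1$ and $N\ge 2w$, every $\mathsf{SBQP}$ algorithm for $\mathsf{AND}_2\circ\mathsf{ApxCount}_{N,w}$ that makes $T$ queries satisfies $$T\ \ge\ c\cdot\min\Bigl\{w,\sqrt{N/w}\Bigr\}.$$ -/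

import Mathlib

namespace SBQPQuery

/-- A promise problem on a set of instances: disjoint sets of yes and no instances. -/
structure PromiseProblem (X : Type) where
  yes : Set X
  no : Set X
  disj : Disjoint yes no

/-- `ApxCount_{N,w}`: given a nonempty `S ⊆ [N]`, decide whether `|S| ≥ 2w` (yes) or
`|S| ≤ w` (no). -/
def ApxCount (N w : ℕ) : PromiseProblem (Finset (Fin N)) where
  yes := {S | S.Nonempty ∧ 2 * w ≤ S.card}
  no := {S | S.Nonempty ∧ S.card ≤ w}
  disj := by
    rw [Set.disjoint_left]
    rintro S ⟨hS, h2⟩ ⟨_, h1⟩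
    have := hS.card_pos
    omega

/-- `AND₂ ∘ f`: both instances satisfy the promise of `f`; the answer is yes exactly when both
are yes instances. -/
def AND₂ {X : Type} (f : PromiseProblem X) : PromiseProblem (X × X) where
  yes := {x | x.1 ∈ f.yes ∧ x.2 ∈ f.yes}
  no := {x | (x.1 ∈ f.yes ∪ f.no ∧ x.2 ∈ f.yes ∪ f.no) ∧ (x.1 ∈ f.no ∨ x.2 ∈ f.no)}
  disj := by
    rw [Set.disjoint_left]
    rintro x ⟨h1, h2⟩ ⟨_, h | h⟩
    · exact Set.disjoint_left.1 f.disj h1 h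
    · exact Set.disjoint_left.1 f.disj h2 h

/-- Computational basis labels `((k, i, b), z)`: `k` selects one of the two oracles, `i ∈ [N]` is
the queried element, `b` is the control bit of the membership oracle, and `z` labels a basis
state of a `d`-dimensional workspace. -/
abbrev Label (N d : ℕ) : Type := (Bool × Fin N × Bool) × Fin d

/-- The phase `1 - 2 b xᵢ`, where `xᵢ` indicates `i ∈ S`; the membership oracle acts by
`O_S |i⟩|b⟩ = (1 - 2 b xᵢ) |i⟩|b⟩`. -/
def membershipPhase {N : ℕ} (S : Finset (Fin N)) (i : Fin N) (b : Bool) : ℂ :=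
  1 - 2 * (if b then 1 else 0) * (if i ∈ S then 1 else 0)

/-- One query to the pair of membership oracles of `(S₀, S₁)`: on `|k⟩|i⟩|b⟩|z⟩` it applies
`O_{S_k}` to `|i⟩|b⟩`. -/
def pairOracle {N : ℕ} (d : ℕ) (S : Finset (Fin N) × Finset (Fin N)) :
    Matrix (Label N d) (Label N d) ℂ :=
  Matrix.diagonal fun x =>
    membershipPhase (if x.1.1 then S.2 else S.1) x.1.2.1 x.1.2.2

/-- A quantum query algorithm with access to membership oracles of two subsets of `[N]`:
it starts in a computational basis state, applies the unitary `U₀`, then alternates queries with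
the unitaries in the list `rounds` (one query before each of them), and finally measures in the
computational basis, accepting when the outcome lies in `accept`. The starting state, the
unitaries and the accepting outcomes do not depend on the sets. -/
structure QueryAlgorithm (N : ℕ) where
  workDim : ℕ
  start : Label N workDim
  U₀ : Matrix.unitaryGroup (Label N workDim) ℂ
  rounds : List (Matrix.unitaryGroup (Label N workDim) ℂ)
  accept : Finset (Label N workDim)

namespace QueryAlgorithm

variable {N : ℕ} (Q : QueryAlgorithm N)

/-- The number of queries, counting both oracles together. -/
def numQueries : ℕ := Q.rounds.length

/-- The state before the final measurement, for the pair of sets `S`. -/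
def finalState (S : Finset (Fin N) × Finset (Fin N)) : Label N Q.workDim → ℂ :=
  Q.rounds.foldl
    (fun ψ U => Matrix.mulVec U.1 (Matrix.mulVec (pairOracle Q.workDim S) ψ))
    (Matrix.mulVec Q.U₀.1 (Pi.single Q.start 1))

/-- The probability that the algorithm accepts the pair of sets `S`. -/
noncomputable def acceptProb (S : Finset (Fin N) × Finset (Fin N)) : ℝ :=
  ∑ x ∈ Q.accept, ‖Q.finalState S x‖ ^ 2

/-- `Q` is an SBQP algorithm for the promise problem `P`: for some threshold `α > 0` that does not
depend on the instance, `Q` accepts every yes instance with probability at least `2α` and every no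
instance with probability at most `α`. -/
def IsSBQP (P : PromiseProblem (Finset (Fin N) × Finset (Fin N))) : Prop :=
  ∃ α : ℝ, 0 < α ∧ (∀ S ∈ P.yes, 2 * α ≤ Q.acceptProb S) ∧ (∀ S ∈ P.no, Q.acceptProb S ≤ α)

end QueryAlgorithm

end SBQPQuery

/-! The proof is the polynomial method. With `T` queries the acceptance probability is a nonnegative
multilinear polynomial `G` of degree `d ≤ 2T` in the two indicator vectors. Suppose `d < w`. Since
`α` may be tiny, `G ≤ 1` says nothing useful off the promise. There the degree gives the bound: a
polynomial of degree below `w` that is at most `β` on sets of size below `w` is at most `β * 3 ^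
|S|` everywhere (`abs_le_three_pow_card`). Used in one argument and then in the other, this yields
`le_of_le_on_no`. Average `G` over independent Bernoulli sets of mean sizes `16ws` and `16w/s`, and
symmetrize. The result is a polynomial `p` of degree at most `d` in `t = s + 1/s`
(`exists_polynomial_bernoulliMean`). At `t = 2` both sets are typically large and `p ≥ 3.98α`. For
`t` between a constant and `N/(16w)` one set is typically small, the off-promise growth is beaten by
exponential tails, and `0 ≤ p ≤ 2.1α`. Such a jump just outside a long interval forces `d² ≳ N/w`,
by the extremality of Chebyshev polynomials. -/

namespace SBQPQuery

/-! ### Multilinear polynomials on sets and pairs of sets -/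

section SetFunctions

variable {𝕜 ι : Type*} [DecidableEq ι]

/-- The monomial `∏_{i ∈ R} xᵢ` as a function of the set with indicator vector `x`. -/
def setMonomial (𝕜 : Type*) [Zero 𝕜] [One 𝕜] (R S : Finset ι) : 𝕜 := if R ⊆ S then 1 else 0

/-- Functions of a finite set given by multilinear polynomials of degree less than `d`. -/
def setPoly (𝕜 ι : Type*) [DecidableEq ι] [Semiring 𝕜] (d : ℕ) : Submodule 𝕜 (Finset ι → 𝕜) :=
  Submodule.span 𝕜 {f | ∃ R : Finset ι, R.card < d ∧ f = setMonomial 𝕜 R}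

/-- Functions of a pair of finite sets given by multilinear polynomials of degree at most `d`. -/
def pairPoly (𝕜 ι : Type*) [DecidableEq ι] [Semiring 𝕜] (d : ℕ) :
    Submodule 𝕜 (Finset ι × Finset ι → 𝕜) :=
  Submodule.span 𝕜 {f | ∃ A B : Finset ι, A.card + B.card ≤ d ∧
    f = fun S => setMonomial 𝕜 A S.1 * setMonomial 𝕜 B S.2}

theorem setMonomial_mem_setPoly [Semiring 𝕜] {d : ℕ} {R : Finset ι} (h : R.card < d) :
    setMonomial 𝕜 R ∈ setPoly 𝕜 ι d :=
  Submodule.subset_span ⟨R, h, rfl⟩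

theorem monomial_mem_pairPoly [Semiring 𝕜] {d : ℕ} {A B : Finset ι} (h : A.card + B.card ≤ d) :
    (fun S : Finset ι × Finset ι => setMonomial 𝕜 A S.1 * setMonomial 𝕜 B S.2) ∈
      pairPoly 𝕜 ι d :=
  Submodule.subset_span ⟨A, B, h, rfl⟩

theorem setMonomial_union [Semiring 𝕜] (A B S : Finset ι) :
    setMonomial 𝕜 (A ∪ B) S = setMonomial 𝕜 A S * setMonomial 𝕜 B S := by
  simp only [setMonomial, Finset.union_subset_iff]
  split_ifs <;> simp_all

theorem setMonomial_insert [Semiring 𝕜] (R S : Finset ι) (a : ι) :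
    setMonomial 𝕜 R (insert a S) = setMonomial 𝕜 (R.erase a) S := by
  simp only [setMonomial, Finset.subset_insert_iff]

/-- The difference in direction `a` lowers the degree. -/
theorem difference_mem_setPoly [CommRing 𝕜] {d : ℕ} {f : Finset ι → 𝕜}
    (hf : f ∈ setPoly 𝕜 ι (d + 1)) (a : ι) :
    (fun S => f (insert a S) - f (S.erase a)) ∈ setPoly 𝕜 ι d := by
  induction hf using Submodule.span_induction with
  | mem f hf =>
    obtain ⟨R, hR, rfl⟩ := hf
    by_cases ha : a ∈ R
    · convert setMonomial_mem_setPoly (𝕜 := 𝕜) (d := d) (R := R.erase a) ?_ using 1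
      · funext S
        rw [setMonomial_insert]
        have : ¬ R ⊆ S.erase a := fun h => Finset.notMem_erase a S (h ha)
        simp [setMonomial, this]
      · rw [Finset.card_erase_of_mem ha]
        have := Finset.card_pos.2 ⟨a, ha⟩
        omega
    · convert (setPoly 𝕜 ι d).zero_mem using 1
      funext S
      rw [setMonomial_insert, Finset.erase_eq_of_notMem ha]
      simp [setMonomial, Finset.subset_erase, ha]
  | zero =>
    convert (setPoly 𝕜 ι d).zero_mem using 1
    funext S
    simp
  | add f g _ _ hf hg =>
    convert add_mem hf hg using 1
    funext S
    simp only [Pi.add_apply]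
    ring
  | smul c f _ hf =>
    convert Submodule.smul_mem _ c hf using 1
    funext S
    simp [mul_sub]

/-- A function of degree less than `d` that is bounded on the sets with fewer than `d` elements
grows at most like `3 ^ |S|`. -/
theorem abs_le_three_pow_card {d : ℕ} {f : Finset ι → ℝ} (hf : f ∈ setPoly ℝ ι d) {β : ℝ}
    (hβ : 0 ≤ β) (hb : ∀ S, S.card < d → |f S| ≤ β) (S : Finset ι) :
    |f S| ≤ β * 3 ^ S.card := by
  induction S using Finset.induction_on generalizing d f β with
  | empty =>
    cases d with
    | zero =>
      have : f = 0 := by simpa [setPoly] using hf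
      simpa [this] using hβ
    | succ d => simpa using hb ∅ (by simp)
  | insert a S ha ih =>
    cases d with
    | zero =>
      have : f = 0 := by simpa [setPoly] using hf
      simp only [this, Pi.zero_apply, abs_zero]
      positivity
    | succ d =>
      have h1 := ih hf hβ hb
      -- The difference loses one degree and at most doubles the bound, so adding an element costs a
      -- factor `1 + 2 = 3`.
      have h2 := ih (difference_mem_setPoly hf a) (β := 2 * β) (by positivity) (fun Q hQ => by
        have i1 := hb (insert a Q) ((Finset.card_insert_le a Q).trans_lt (by omega))
        have i2 := hb (Q.erase a) ((Finset.card_erase_le).trans_lt (by omega))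
        have := abs_sub (f (insert a Q)) (f (Q.erase a))
        linarith)
      rw [Finset.erase_eq_of_notMem ha] at h2
      rw [Finset.card_insert_of_notMem ha, pow_succ]
      have := abs_add_le (f (insert a S) - f S) (f S)
      rw [sub_add_cancel] at this
      linarith

theorem const_mem_pairPoly [CommSemiring 𝕜] (c : 𝕜) (d : ℕ) :
    (fun _ => c) ∈ pairPoly 𝕜 ι d := by
  convert Submodule.smul_mem _ c
    (monomial_mem_pairPoly (𝕜 := 𝕜) (ι := ι) (d := d) (A := ∅) (B := ∅) (by simp)) using 1
  funext S
  simp [setMonomial]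

theorem mul_mem_pairPoly [CommSemiring 𝕜] {d e : ℕ} {f g : Finset ι × Finset ι → 𝕜}
    (hf : f ∈ pairPoly 𝕜 ι d) (hg : g ∈ pairPoly 𝕜 ι e) : f * g ∈ pairPoly 𝕜 ι (d + e) := by
  have h := Submodule.mul_mem_mul hf hg
  rw [pairPoly, pairPoly, Submodule.span_mul_span] at h
  refine Submodule.span_le.2 ?_ h
  rintro _ ⟨_, ⟨A, B, h, rfl⟩, _, ⟨A', B', h', rfl⟩, rfl⟩
  rw [SetLike.mem_coe]
  convert monomial_mem_pairPoly (𝕜 := 𝕜) (d := d + e) (A := A ∪ A') (B := B ∪ B') ?_ using 1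
  · funext S
    simp only [Pi.mul_apply, setMonomial_union]
    ring
  · have := Finset.card_union_le A A'
    have := Finset.card_union_le B B'
    omega

theorem swap_mem_pairPoly [CommSemiring 𝕜] {d : ℕ} {f : Finset ι × Finset ι → 𝕜}
    (hf : f ∈ pairPoly 𝕜 ι d) : (fun S => f S.swap) ∈ pairPoly 𝕜 ι d := by
  refine (Submodule.span_le (p := (pairPoly 𝕜 ι d).comap
    (LinearMap.funLeft 𝕜 𝕜 Prod.swap))).2 ?_ hf
  rintro _ ⟨A, B, h, rfl⟩
  rw [SetLike.mem_coe, Submodule.mem_comap]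
  convert monomial_mem_pairPoly (𝕜 := 𝕜) (d := d) (A := B) (B := A) (by omega) using 1
  funext S
  simp [LinearMap.funLeft_apply, mul_comm]

theorem insert_mem_pairPoly [CommSemiring 𝕜] {d : ℕ} {f : Finset ι × Finset ι → 𝕜}
    (hf : f ∈ pairPoly 𝕜 ι d) (a : ι) :
    (fun S => f (insert a S.1, insert a S.2)) ∈ pairPoly 𝕜 ι d := by
  refine (Submodule.span_le (p := (pairPoly 𝕜 ι d).comap
    (LinearMap.funLeft 𝕜 𝕜 fun S => (insert a S.1, insert a S.2)))).2 ?_ hf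
  rintro _ ⟨A, B, h, rfl⟩
  rw [SetLike.mem_coe, Submodule.mem_comap]
  convert monomial_mem_pairPoly (𝕜 := 𝕜) (d := d) (A := A.erase a) (B := B.erase a) ?_ using 1
  · funext S
    simp [LinearMap.funLeft_apply, setMonomial_insert]
  · have := Finset.card_erase_le (s := A) (a := a)
    have := Finset.card_erase_le (s := B) (a := a)
    omega

theorem section_mem_setPoly [CommSemiring 𝕜] {d e : ℕ} (hde : d < e)
    {f : Finset ι × Finset ι → 𝕜} (hf : f ∈ pairPoly 𝕜 ι d) (B : Finset ι) :
    (fun S => f (S, B)) ∈ setPoly 𝕜 ι e := by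
  refine (Submodule.span_le (p := (setPoly 𝕜 ι e).comap
    (LinearMap.funLeft 𝕜 𝕜 fun S => (S, B)))).2 ?_ hf
  rintro _ ⟨A, C, h, rfl⟩
  rw [SetLike.mem_coe, Submodule.mem_comap]
  convert Submodule.smul_mem _ (setMonomial 𝕜 C B)
    (setMonomial_mem_setPoly (𝕜 := 𝕜) (d := e) (R := A) (by omega)) using 1
  funext S
  simp [LinearMap.funLeft_apply, mul_comm]

theorem normSq_mem_pairPoly {d : ℕ} {f : Finset ι × Finset ι → ℂ} (hf : f ∈ pairPoly ℂ ι d) :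
    (fun S => ‖f S‖ ^ 2) ∈ pairPoly ℝ ι (2 * d) := by
  have key : (fun S => (f S).re) ∈ pairPoly ℝ ι d ∧ (fun S => (f S).im) ∈ pairPoly ℝ ι d := by
    induction hf using Submodule.span_induction with
    | mem f hf =>
      obtain ⟨A, B, h, rfl⟩ := hf
      constructor
      · convert monomial_mem_pairPoly (𝕜 := ℝ) h using 1
        funext S
        simp only [setMonomial]
        split_ifs <;> simp
      · convert (pairPoly ℝ ι d).zero_mem using 1
        funext S
        simp only [setMonomial]
        split_ifs <;> simp
    | zero => exact ⟨(pairPoly ℝ ι d).zero_mem, (pairPoly ℝ ι d).zero_mem⟩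
    | add f g _ _ hf hg => exact ⟨add_mem hf.1 hg.1, add_mem hf.2 hg.2⟩
    | smul c f _ hf =>
      constructor
      · convert sub_mem (Submodule.smul_mem _ c.re hf.1) (Submodule.smul_mem _ c.im hf.2) using 1
        funext S
        simp
      · convert add_mem (Submodule.smul_mem _ c.re hf.2) (Submodule.smul_mem _ c.im hf.1) using 1
        funext S
        simp
  rw [two_mul]
  convert add_mem (mul_mem_pairPoly key.1 key.1) (mul_mem_pairPoly key.2 key.2) using 1
  funext S
  simp only [Pi.add_apply, Pi.mul_apply, ← Complex.normSq_apply, Complex.sq_norm]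

end SetFunctions

/-! ### Degree of the acceptance probability -/

section Amplitudes

variable {N : ℕ}

theorem membershipPhase_mem_pairPoly (k : Bool) (i : Fin N) (b : Bool) :
    (fun S : Finset (Fin N) × Finset (Fin N) =>
      membershipPhase (if k then S.2 else S.1) i b) ∈ pairPoly ℂ (Fin N) 1 := by
  have h : (fun S : Finset (Fin N) × Finset (Fin N) =>
      setMonomial ℂ (if k then ∅ else {i}) S.1 * setMonomial ℂ (if k then {i} else ∅) S.2) ∈
      pairPoly ℂ (Fin N) 1 := monomial_mem_pairPoly (by cases k <;> simp)
  convert sub_mem (const_mem_pairPoly 1 1) (Submodule.smul_mem _ (2 * if b then 1 else 0) h) using 1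
  funext S
  cases k <;> cases b <;> simp [membershipPhase, setMonomial]

theorem mulVec_mem_pairPoly {d n : ℕ} (U : Matrix (Label N n) (Label N n) ℂ)
    {ψ : Finset (Fin N) × Finset (Fin N) → Label N n → ℂ}
    (hψ : ∀ x, (fun S => ψ S x) ∈ pairPoly ℂ (Fin N) d) (x : Label N n) :
    (fun S => U.mulVec (ψ S) x) ∈ pairPoly ℂ (Fin N) d := by
  convert Submodule.sum_mem (t := Finset.univ) _
    (fun y _ => Submodule.smul_mem _ (U x y) (hψ y)) using 1
  funext S
  simp [Matrix.mulVec, dotProduct]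

theorem pairOracle_mulVec_mem_pairPoly {d n : ℕ}
    {ψ : Finset (Fin N) × Finset (Fin N) → Label N n → ℂ}
    (hψ : ∀ x, (fun S => ψ S x) ∈ pairPoly ℂ (Fin N) d) (x : Label N n) :
    (fun S => (pairOracle n S).mulVec (ψ S) x) ∈ pairPoly ℂ (Fin N) (d + 1) := by
  rw [add_comm]
  convert mul_mem_pairPoly (membershipPhase_mem_pairPoly x.1.1 x.1.2.1 x.1.2.2) (hψ x) using 1
  funext S
  simp [pairOracle, Matrix.mulVec_diagonal]

theorem foldl_mem_pairPoly {d n : ℕ} (l : List (Matrix.unitaryGroup (Label N n) ℂ))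
    {ψ : Finset (Fin N) × Finset (Fin N) → Label N n → ℂ}
    (hψ : ∀ x, (fun S => ψ S x) ∈ pairPoly ℂ (Fin N) d) (x : Label N n) :
    (fun S => l.foldl
      (fun ψ U => Matrix.mulVec U.1 (Matrix.mulVec (pairOracle n S) ψ)) (ψ S) x) ∈
      pairPoly ℂ (Fin N) (d + l.length) := by
  induction l generalizing d ψ with
  | nil => exact hψ x
  | cons U l ih =>
    simp only [List.foldl_cons, List.length_cons]
    rw [← add_assoc, add_right_comm]
    exact ih (ψ := fun S => Matrix.mulVec U.1 (Matrix.mulVec (pairOracle n S) (ψ S)))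
      (mulVec_mem_pairPoly U.1 (pairOracle_mulVec_mem_pairPoly hψ))

/-- The acceptance probability of an algorithm with `T` queries is a multilinear polynomial of
degree at most `2T`. -/
theorem acceptProb_mem_pairPoly (Q : QueryAlgorithm N) :
    Q.acceptProb ∈ pairPoly ℝ (Fin N) (2 * Q.numQueries) := by
  have h := fun x => normSq_mem_pairPoly (foldl_mem_pairPoly (d := 0) Q.rounds
    (mulVec_mem_pairPoly Q.U₀.1
      (ψ := fun _ => Pi.single Q.start 1) (fun y => const_mem_pairPoly _ 0)) x)
  rw [zero_add] at h
  change _ ∈ pairPoly ℝ (Fin N) (2 * Q.rounds.length)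
  convert Submodule.sum_mem (t := Q.accept) _ (fun x _ => h x) using 1
  funext S
  simp [QueryAlgorithm.acceptProb, QueryAlgorithm.finalState]

end Amplitudes

/-! ### Bernoulli averages and symmetrization along a hyperbola -/

section Bernoulli

variable {ι : Type*} [Fintype ι] [DecidableEq ι]

/-- The probability of the set `S` when every element is included independently with
probability `u`. -/
def bernoulliWeight (u : ℝ) (S : Finset ι) : ℝ := u ^ S.card * (1 - u) ^ (Sᶜ).card

theorem bernoulliWeight_nonneg {u : ℝ} (h0 : 0 ≤ u) (h1 : u ≤ 1) (S : Finset ι) :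
    0 ≤ bernoulliWeight u S :=
  mul_nonneg (pow_nonneg h0 _) (pow_nonneg (sub_nonneg.2 h1) _)

theorem sum_bernoulliWeight_mul_pow (u y : ℝ) :
    ∑ S : Finset ι, bernoulliWeight u S * y ^ S.card = (u * y + (1 - u)) ^ Fintype.card ι := by
  rw [← Fintype.sum_pow_mul_eq_add_pow]
  refine Finset.sum_congr rfl fun S _ => ?_
  rw [bernoulliWeight, Finset.card_compl, mul_pow]
  ring

theorem sum_bernoulliWeight (u : ℝ) : ∑ S : Finset ι, bernoulliWeight u S = 1 := by
  simpa using sum_bernoulliWeight_mul_pow (ι := ι) u 1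

theorem sum_bernoulliWeight_mul_setMonomial (u : ℝ) (A : Finset ι) :
    ∑ S : Finset ι, bernoulliWeight u S * setMonomial ℝ A S = u ^ A.card := by
  -- The zero factors on `A` kill every term whose set does not contain `A`.
  have h := Finset.prod_add (fun _ : ι => u) (fun i => if i ∈ A then 0 else 1 - u) Finset.univ
  rw [Finset.powerset_univ] at h
  have h1 : ∏ i : ι, (u + if i ∈ A then 0 else 1 - u) = u ^ A.card := by
    have : ∀ i : ι, (u + if i ∈ A then 0 else 1 - u) = if i ∈ A then u else 1 := fun i => by
      split_ifs <;> ring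
    simp_rw [this, Finset.prod_ite_mem, Finset.univ_inter, Finset.prod_const]
  rw [← h1, h]
  refine Finset.sum_congr rfl fun S _ => ?_
  rw [Finset.prod_const, bernoulliWeight, mul_assoc, ← Finset.compl_eq_univ_sdiff]
  congr 1
  by_cases hA : A ⊆ S
  · rw [setMonomial, if_pos hA, mul_one, ← Finset.prod_const]
    refine Finset.prod_congr rfl fun i hi => ?_
    rw [if_neg fun hiA => Finset.mem_compl.1 hi (hA hiA)]
  · obtain ⟨i, hiA, hiS⟩ := Finset.not_subset.1 hA
    have : ∏ i ∈ Sᶜ, (if i ∈ A then 0 else 1 - u) = 0 :=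
      Finset.prod_eq_zero (Finset.mem_compl.2 hiS) (if_pos hiA)
    rw [setMonomial, if_neg hA, mul_zero, this]

/-- The expectation of `f` at a pair of independent random sets, which include every element
with probability `u` and `v` respectively. -/
def bernoulliMean (u v : ℝ) : (Finset ι × Finset ι → ℝ) →ₗ[ℝ] ℝ where
  toFun f := ∑ A, ∑ B, bernoulliWeight u A * bernoulliWeight v B * f (A, B)
  map_add' f g := by simp [mul_add, Finset.sum_add_distrib]
  map_smul' c f := by
    simp only [Pi.smul_apply, smul_eq_mul, RingHom.id_apply, Finset.mul_sum]
    exact Finset.sum_congr rfl fun A _ => Finset.sum_congr rfl fun B _ => by ring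

theorem bernoulliMean_mul (u v : ℝ) (f g : Finset ι → ℝ) :
    bernoulliMean u v (fun S => f S.1 * g S.2) =
      (∑ A, bernoulliWeight u A * f A) * ∑ B, bernoulliWeight v B * g B := by
  rw [Finset.sum_mul_sum]
  exact Finset.sum_congr rfl fun A _ => Finset.sum_congr rfl fun B _ => by ring

theorem bernoulliMean_mono {u v : ℝ} (hu0 : 0 ≤ u) (hu1 : u ≤ 1) (hv0 : 0 ≤ v) (hv1 : v ≤ 1)
    {f g : Finset ι × Finset ι → ℝ} (h : ∀ S, f S ≤ g S) :
    bernoulliMean u v f ≤ bernoulliMean u v g :=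
  Finset.sum_le_sum fun A _ => Finset.sum_le_sum fun B _ =>
    mul_le_mul_of_nonneg_left (h _) (mul_nonneg (bernoulliWeight_nonneg hu0 hu1 A)
      (bernoulliWeight_nonneg hv0 hv1 B))

theorem bernoulliMean_swap (u v : ℝ) (f : Finset ι × Finset ι → ℝ) :
    bernoulliMean u v (fun S => f S.swap) = bernoulliMean v u f := by
  change ∑ A, ∑ B, _ = ∑ A, ∑ B, _
  rw [Finset.sum_comm]
  exact Finset.sum_congr rfl fun A _ => Finset.sum_congr rfl fun B _ => by
    simp only [Prod.swap_prod_mk]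
    ring

-- These are the rescaled Chebyshev polynomials `2 T_n(t / 2)`, built by their three-term
-- recurrence.
open Polynomial in
theorem exists_polynomial_eval_add_inv (n : ℕ) :
    ∃ p : ℝ[X], p.natDegree ≤ n ∧ ∀ s : ℝ, s ≠ 0 → p.eval (s + s⁻¹) = s ^ n + s⁻¹ ^ n := by
  induction n using Nat.strong_induction_on with
  | _ n ih =>
    match n with
    | 0 => exact ⟨C 2, by simp, fun s _ => by norm_num⟩
    | 1 => exact ⟨X, by simp, fun s _ => by simp⟩
    | n + 2 =>
      obtain ⟨p, hp, hps⟩ := ih n (by omega)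
      obtain ⟨q, hq, hqs⟩ := ih (n + 1) (by omega)
      refine ⟨X * q - p, ?_, fun s hs => ?_⟩
      · refine (natDegree_sub_le _ _).trans (max_le (natDegree_mul_le.trans ?_) (by omega))
        rw [natDegree_X]
        omega
      · rw [eval_sub, eval_mul, eval_X, hps s hs, hqs s hs]
        have : s * s⁻¹ = 1 := mul_inv_cancel₀ hs
        linear_combination (s ^ n + s⁻¹ ^ n) * this

theorem pow_mul_pow_add_pow_mul_pow_of_le {s : ℝ} (hs : s ≠ 0) {i j : ℕ} (h : j ≤ i) :
    s ^ i * s⁻¹ ^ j + s⁻¹ ^ i * s ^ j = s ^ (i - j) + s⁻¹ ^ (i - j) := by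
  obtain ⟨k, rfl⟩ := Nat.exists_eq_add_of_le h
  have : s ^ j * s⁻¹ ^ j = 1 := by rw [← mul_pow, mul_inv_cancel₀ hs, one_pow]
  rw [Nat.add_sub_cancel_left, pow_add, pow_add]
  linear_combination (s ^ k + s⁻¹ ^ k) * this

/-- Along a hyperbola, the symmetrized mean of a polynomial of degree at most `d` is a polynomial
of degree at most `d` in `s + s⁻¹`. -/
theorem exists_polynomial_bernoulliMean {d : ℕ} {f : Finset ι × Finset ι → ℝ}
    (hf : f ∈ pairPoly ℝ ι d) (x : ℝ) :
    ∃ p : Polynomial ℝ, p.natDegree ≤ d ∧ ∀ s : ℝ, s ≠ 0 → p.eval (s + s⁻¹) =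
      bernoulliMean (x * s) (x * s⁻¹) f + bernoulliMean (x * s⁻¹) (x * s) f := by
  induction hf using Submodule.span_induction with
  | mem f hf =>
    obtain ⟨A, B, h, rfl⟩ := hf
    -- With truncated subtraction the index is the absolute difference of the two sizes: the mean
    -- `(x * s) ^ |A| * (x / s) ^ |B|` has only this power of `s` or its inverse.
    obtain ⟨p, hp, hps⟩ := exists_polynomial_eval_add_inv (A.card - B.card + (B.card - A.card))
    refine ⟨Polynomial.C (x ^ (A.card + B.card)) * p,
      (Polynomial.natDegree_C_mul_le _ _).trans (hp.trans (by omega)), fun s hs => ?_⟩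
    rw [Polynomial.eval_mul, Polynomial.eval_C, hps s hs]
    simp only [bernoulliMean_mul, sum_bernoulliWeight_mul_setMonomial, mul_pow]
    rcases le_total B.card A.card with hAB | hAB
    · have := pow_mul_pow_add_pow_mul_pow_of_le hs hAB
      rw [Nat.sub_eq_zero_of_le hAB, add_zero, ← this]
      ring
    · have := pow_mul_pow_add_pow_mul_pow_of_le hs hAB
      rw [Nat.sub_eq_zero_of_le hAB, zero_add, ← this]
      ring
  | zero => exact ⟨0, by simp, fun s _ => by simp⟩
  | add f g _ _ hf hg =>
    obtain ⟨p, hp, hps⟩ := hf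
    obtain ⟨q, hq, hqs⟩ := hg
    refine ⟨p + q, (Polynomial.natDegree_add_le _ _).trans (max_le hp hq), fun s hs => ?_⟩
    rw [Polynomial.eval_add, hps s hs, hqs s hs, map_add, map_add]
    ring
  | smul c f _ hf =>
    obtain ⟨p, hp, hps⟩ := hf
    refine ⟨Polynomial.C c * p, (Polynomial.natDegree_C_mul_le _ _).trans hp, fun s hs => ?_⟩
    rw [Polynomial.eval_mul, Polynomial.eval_C, hps s hs, map_smul, map_smul]
    simp only [smul_eq_mul]
    ring

end Bernoulli

/-! ### Growth of polynomials outside an interval -/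

section Chebyshev

/-- For `1 + μ = cosh θ` the value is `cosh (nθ) ≤ exp (n²θ²/2)`, and `μ = 2 sinh² (θ/2) ≥ θ²/2`. -/
theorem eval_chebyshevT_one_add_le (n : ℕ) {μ : ℝ} (hμ : 0 ≤ μ) :
    (Polynomial.Chebyshev.T ℝ n).eval (1 + μ) ≤ Real.exp (n ^ 2 * μ) := by
  set θ := Real.arcosh (1 + μ) with hθ
  have h1 : Real.cosh θ = 1 + μ := Real.cosh_arcosh (by linarith)
  have hθ0 : 0 ≤ θ := Real.arcosh_nonneg (by linarith)
  have h2 : θ ^ 2 / 2 ≤ μ := by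
    have h3 := Real.cosh_two_mul (θ / 2)
    have h4 := Real.cosh_sq (θ / 2)
    have h5 : θ / 2 ≤ Real.sinh (θ / 2) := Real.self_le_sinh_iff.2 (by linarith)
    have h6 : (θ / 2) ^ 2 ≤ Real.sinh (θ / 2) ^ 2 := by gcongr
    rw [mul_div_cancel₀ θ two_ne_zero] at h3
    linarith
  rw [← h1, Polynomial.Chebyshev.T_real_cosh]
  refine (Real.cosh_le_exp_half_sq _).trans (Real.exp_le_exp.2 ?_)
  push_cast
  have := mul_le_mul_of_nonneg_left h2 (sq_nonneg (n : ℝ))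
  linarith

/-- A polynomial of degree at most `n` with values in `[0, β]` on `[a, b]` grows slowly to the left
of this interval. -/
theorem eval_le_of_mem_Icc_zero {n : ℕ} {p : Polynomial ℝ} (hp : p.natDegree ≤ n) {a b β x : ℝ}
    (hab : a < b) (hβ : 0 < β) (hx : x ≤ a)
    (h : ∀ t ∈ Set.Icc a b, 0 ≤ p.eval t ∧ p.eval t ≤ β) :
    p.eval x ≤ β / 2 * (1 + Real.exp (n ^ 2 * (2 * (a - x) / (b - a)))) := by
  have hba : 0 < b - a := by linarith
  -- An orientation-reversing affine map from `[-1, 1]` onto `[a, b]`, so that points left of `a`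
  -- come from points right of `1`.
  set ℓ : Polynomial ℝ := Polynomial.C ((a + b) / 2) - Polynomial.C ((b - a) / 2) * Polynomial.X
    with hℓ
  have hℓdeg : ℓ.natDegree ≤ 1 := by
    rw [hℓ]
    compute_degree
  have hℓe : ∀ y, ℓ.eval y = (a + b) / 2 - (b - a) / 2 * y := fun y => by simp [hℓ]
  set q : Polynomial ℝ := Polynomial.C (2 / β) * p.comp ℓ - Polynomial.C 1 with hq
  have hqe : ∀ y, q.eval y = 2 / β * p.eval (ℓ.eval y) - 1 := fun y => by simp [hq]
  have hqdeg : q.degree ≤ n := by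
    refine Polynomial.degree_le_of_natDegree_le ((Polynomial.natDegree_sub_le _ _).trans
      (max_le ((Polynomial.natDegree_C_mul_le _ _).trans
        (Polynomial.natDegree_comp_le.trans ?_)) (by simp)))
    calc p.natDegree * ℓ.natDegree ≤ n * 1 := Nat.mul_le_mul hp hℓdeg
      _ = n := mul_one n
  have hqb : ∀ y ∈ Set.Icc (-1 : ℝ) 1, |q.eval y| ≤ 1 := fun y hy => by
    obtain ⟨h0, h1⟩ := h (ℓ.eval y) (by
      rw [hℓe]
      constructor <;> nlinarith [hy.1, hy.2])
    have h2 : 0 ≤ 2 / β * p.eval (ℓ.eval y) := by positivity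
    have h3 : 2 / β * p.eval (ℓ.eval y) ≤ 2 / β * β := by gcongr
    rw [div_mul_cancel₀ _ hβ.ne'] at h3
    rw [hqe, abs_le]
    constructor <;> linarith
  have hμ : 0 ≤ 2 * (a - x) / (b - a) := div_nonneg (by linarith) hba.le
  have key := Polynomial.Chebyshev.eval_iterate_derivative_le_of_forall_abs_le_one (k := 0)
    (x := 1 + 2 * (a - x) / (b - a)) (by linarith) hqdeg hqb
  simp only [Function.iterate_zero, id_eq] at key
  have key2 := key.trans (eval_chebyshevT_one_add_le n hμ)
  have hxe : ℓ.eval (1 + 2 * (a - x) / (b - a)) = x := by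
    rw [hℓe]
    field_simp
    ring
  rw [hqe, hxe] at key2
  have : p.eval x = β / 2 * (2 / β * p.eval x) := by field_simp
  rw [this]
  gcongr
  linarith

end Chebyshev

/-! ### Pointwise bound beyond the promise, and its averages -/

/-- The growth bound is rewritten as a product so that its Bernoulli mean factors. The first factor
is close to `1` on average if `A` has mean size at least `16w`, the second if `B` has mean size at
most `w / 300`. -/
theorem le_of_le_on_no {ι : Type*} [DecidableEq ι] {w d : ℕ}
    {G : Finset ι × Finset ι → ℝ} {α : ℝ} (hdw : d < w) (hG : G ∈ pairPoly ℝ ι d) (hα : 0 ≤ α) (h0 : ∀ S, 0 ≤ G S)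
    (hno : ∀ A B, B.card < w → A.card < w ∨ 2 * w ≤ A.card → G (A, B) ≤ α) (A B : Finset ι) :
    G (A, B) ≤ α * ((1 + 36 ^ w * (1 / 2) ^ A.card) * (1 + (1 / 100) ^ w * 300 ^ B.card)) := by
  have habs : ∀ S, |G S| = G S := fun S => abs_of_nonneg (h0 S)
  have hH : ∀ A : Finset ι, (1 : ℝ) ≤ 1 + 36 ^ w * (1 / 2) ^ A.card := fun A =>
    le_add_of_nonneg_right (by positivity)
  have step : ∀ A B : Finset ι, B.card < w → G (A, B) ≤ α * (1 + 36 ^ w * (1 / 2) ^ A.card) := by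
    intro A B hB
    by_cases hA : A.card < w ∨ 2 * w ≤ A.card
    · exact (hno A B hB hA).trans (le_mul_of_one_le_right hα (hH A))
    · have h1 := abs_le_three_pow_card (section_mem_setPoly hdw hG B) hα
        (fun S hS => by rw [habs]; exact hno S B hB (Or.inl hS)) A
      rw [habs] at h1
      refine h1.trans (mul_le_mul_of_nonneg_left ?_ hα)
      -- Only `w ≤ |A| < 2w` remains, so `3 ^ |A|` can be traded for a function that decays in
      -- `|A|`.
      have h2 : (6 : ℝ) ^ A.card ≤ 6 ^ (2 * w) := pow_le_pow_right₀ (by norm_num) (by omega)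
      calc (3 : ℝ) ^ A.card = 6 ^ A.card * (1 / 2) ^ A.card := by rw [← mul_pow]; norm_num
        _ ≤ 6 ^ (2 * w) * (1 / 2) ^ A.card := by gcongr
        _ = 36 ^ w * (1 / 2) ^ A.card := by rw [pow_mul]; norm_num
        _ ≤ _ := by linarith
  have hβ : 0 ≤ α * (1 + 36 ^ w * (1 / 2) ^ A.card) := by positivity
  rw [← mul_assoc]
  by_cases hB : B.card < w
  · exact (step A B hB).trans (le_mul_of_one_le_right hβ (le_add_of_nonneg_right (by positivity)))
  · have h1 := abs_le_three_pow_card (section_mem_setPoly hdw (swap_mem_pairPoly hG) A) hβ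
      (fun S hS => by rw [habs]; exact step A S hS) B
    rw [habs] at h1
    refine h1.trans (mul_le_mul_of_nonneg_left ?_ hβ)
    have h2 : (100 : ℝ) ^ w ≤ 100 ^ B.card := pow_le_pow_right₀ (by norm_num) (by omega)
    calc (3 : ℝ) ^ B.card = (1 / 100) ^ w * 100 ^ w * 3 ^ B.card := by rw [← mul_pow]; norm_num
      _ ≤ (1 / 100) ^ w * 100 ^ B.card * 3 ^ B.card := by gcongr
      _ = (1 / 100) ^ w * 300 ^ B.card := by rw [mul_assoc, ← mul_pow]; norm_num
      _ ≤ _ := by linarith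

section MeanBounds

variable {ι : Type*} [Fintype ι] [DecidableEq ι] {w d : ℕ} {G : Finset ι × Finset ι → ℝ} {α : ℝ}

theorem exp_neg_eight_le : Real.exp (-8) ≤ 1 / 2800 := by
  have h : (2.7 : ℝ) ^ 8 ≤ Real.exp 1 ^ 8 := by
    gcongr
    linarith [Real.exp_one_gt_d9]
  rw [← Real.exp_nat_mul] at h
  rw [Real.exp_neg, one_div]
  refine inv_anti₀ (by norm_num) ?_
  norm_num at h ⊢
  linarith

/-- Exponential lower-tail bound: `(1 - u/2) ^ n ≤ exp (-un/2) ≤ exp (-8w)`, which beats `c ^ w`. -/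
theorem pow_mul_sum_half_pow_le (hw : 1 ≤ w) {u c : ℝ} (hc0 : 0 ≤ c) (hc : c ≤ 2800)
    (hu1 : u ≤ 1) (hu : 16 * w ≤ u * Fintype.card ι) :
    ∑ S : Finset ι, bernoulliWeight u S * (c ^ w * (1 / 2) ^ S.card) ≤ c / 2800 := by
  have e : ∑ S : Finset ι, bernoulliWeight u S * (c ^ w * (1 / 2) ^ S.card) =
      c ^ w * ∑ S : Finset ι, bernoulliWeight u S * (1 / 2) ^ S.card := by
    rw [Finset.mul_sum]
    exact Finset.sum_congr rfl fun S _ => by ring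
  rw [e, sum_bernoulliWeight_mul_pow]
  have h1 : (u * (1 / 2) + (1 - u)) ^ Fintype.card ι ≤ (1 / 2800) ^ w := by
    calc (u * (1 / 2) + (1 - u)) ^ Fintype.card ι
        ≤ Real.exp (-(u / 2)) ^ Fintype.card ι := by
          refine pow_le_pow_left₀ (by linarith) ?_ _
          linarith [Real.add_one_le_exp (-(u / 2))]
      _ = Real.exp (-(u * Fintype.card ι / 2)) := by
          rw [← Real.exp_nat_mul]
          ring_nf
      _ ≤ Real.exp (w * (-8)) := Real.exp_le_exp.2 (by linarith)
      _ = Real.exp (-8) ^ w := Real.exp_nat_mul _ _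
      _ ≤ _ := by
          gcongr
          exact exp_neg_eight_le
  calc _ ≤ c ^ w * (1 / 2800) ^ w := by gcongr
    _ = (c / 2800) ^ w := by rw [← mul_pow, mul_one_div]
    _ ≤ c / 2800 := pow_le_of_le_one (by positivity) (by linarith) (by omega)

/-- Exponential upper-tail bound: `(1 + 299v) ^ n ≤ exp (299vn) ≤ e ^ w`, which `100 ^ (-w)` beats.
-/
theorem pow_mul_sum_pow_le (hw : 1 ≤ w) {v : ℝ} (hv0 : 0 ≤ v)
    (hv : v * Fintype.card ι ≤ w / 300) :
    ∑ S : Finset ι, bernoulliWeight v S * ((1 / 100) ^ w * 300 ^ S.card) ≤ 0.028 := by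
  have e : ∑ S : Finset ι, bernoulliWeight v S * ((1 / 100) ^ w * 300 ^ S.card) =
      (1 / 100) ^ w * ∑ S : Finset ι, bernoulliWeight v S * 300 ^ S.card := by
    rw [Finset.mul_sum]
    exact Finset.sum_congr rfl fun S _ => by ring
  rw [e, sum_bernoulliWeight_mul_pow]
  have h1 : (v * 300 + (1 - v)) ^ Fintype.card ι ≤ 2.8 ^ w := by
    calc (v * 300 + (1 - v)) ^ Fintype.card ι
        ≤ Real.exp (299 * v) ^ Fintype.card ι := by
          refine pow_le_pow_left₀ (by linarith) ?_ _
          linarith [Real.add_one_le_exp (299 * v)]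
      _ = Real.exp (299 * (v * Fintype.card ι)) := by
          rw [← Real.exp_nat_mul]
          ring_nf
      _ ≤ Real.exp (w * 1) := Real.exp_le_exp.2 (by linarith [Nat.cast_nonneg (α := ℝ) w])
      _ = Real.exp 1 ^ w := Real.exp_nat_mul _ _
      _ ≤ _ := by
          gcongr
          linarith [Real.exp_one_lt_d9]
  calc _ ≤ (1 / 100 : ℝ) ^ w * 2.8 ^ w := by gcongr
    _ = 0.028 ^ w := by rw [← mul_pow]; norm_num
    _ ≤ 0.028 := pow_le_of_le_one (by norm_num) (by norm_num) (by omega)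

theorem bernoulliMean_le_of_le_on_no (hw : 1 ≤ w) (hdw : d < w) (hG : G ∈ pairPoly ℝ ι d)
    (hα : 0 ≤ α) (h0 : ∀ S, 0 ≤ G S)
    (hno : ∀ A B, B.card < w → A.card < w ∨ 2 * w ≤ A.card → G (A, B) ≤ α)
    {u v : ℝ} (hu0 : 0 ≤ u) (hu1 : u ≤ 1) (hv0 : 0 ≤ v) (hv1 : v ≤ 1)
    (hu : 16 * w ≤ u * Fintype.card ι) (hv : v * Fintype.card ι ≤ w / 300) :
    bernoulliMean u v G ≤ 1.05 * α := by
  have h1 := bernoulliMean_mono hu0 hu1 hv0 hv1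
    (f := G) (g := α • fun S => (1 + 36 ^ w * (1 / 2) ^ S.1.card) *
      (1 + (1 / 100) ^ w * 300 ^ S.2.card)) (fun S => le_of_le_on_no hdw hG hα h0 hno S.1 S.2)
  have h2 := pow_mul_sum_half_pow_le (ι := ι) hw (by norm_num : (0 : ℝ) ≤ 36) (by norm_num) hu1 hu
  have h3 := pow_mul_sum_pow_le (ι := ι) hw hv0 hv
  rw [map_smul, bernoulliMean_mul u v (fun A => 1 + 36 ^ w * (1 / 2) ^ A.card)
    (fun B => 1 + (1 / 100) ^ w * 300 ^ B.card)] at h1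
  simp only [mul_add, mul_one, Finset.sum_add_distrib, sum_bernoulliWeight, smul_eq_mul] at h1
  have h4 : 0 ≤ ∑ S : Finset ι, bernoulliWeight v S * ((1 / 100) ^ w * 300 ^ S.card) :=
    Finset.sum_nonneg fun S _ => mul_nonneg (bernoulliWeight_nonneg hv0 hv1 S) (by positivity)
  set X := ∑ S : Finset ι, bernoulliWeight u S * (36 ^ w * (1 / 2) ^ S.card)
  set Y := ∑ S : Finset ι, bernoulliWeight v S * ((1 / 100) ^ w * 300 ^ S.card)
  have h5 : (1 + X) * (1 + Y) ≤ 1.05 := by nlinarith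
  linarith [mul_le_mul_of_nonneg_left h5 hα]

/-- A union bound: since `F ≥ 1` on sets below `2w` and `G ≥ 0`, the function `2α (1 - F A - F B)`
lies below `G` everywhere. -/
theorem le_bernoulliMean_of_le_on_yes (hw : 1 ≤ w) (hα : 0 ≤ α) (h0 : ∀ S, 0 ≤ G S)
    (hyes : ∀ A B, 2 * w ≤ A.card → 2 * w ≤ B.card → 2 * α ≤ G (A, B))
    {u : ℝ} (hu0 : 0 ≤ u) (hu1 : u ≤ 1) (hu : 16 * w ≤ u * Fintype.card ι) :
    1.99 * α ≤ bernoulliMean u u G := by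
  set F : Finset ι → ℝ := fun A => 4 ^ w * (1 / 2) ^ A.card with hF
  have hF0 : ∀ A, 0 ≤ F A := fun A => by positivity
  have hF1 : ∀ A : Finset ι, ¬ 2 * w ≤ A.card → 1 ≤ F A := fun A hA => by
    have : (2 : ℝ) ^ A.card ≤ 2 ^ (2 * w) := pow_le_pow_right₀ (by norm_num) (by omega)
    calc (1 : ℝ) = 2 ^ A.card * (1 / 2) ^ A.card := by rw [← mul_pow]; norm_num
      _ ≤ 2 ^ (2 * w) * (1 / 2) ^ A.card := by gcongr
      _ = F A := by rw [hF, pow_mul]; norm_num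
  have h1 := bernoulliMean_mono hu0 hu1 hu0 hu1 (g := G)
    (f := (2 * α) • ((fun S => (1 : Finset ι → ℝ) S.1 * (1 : Finset ι → ℝ) S.2) -
      (fun S => F S.1 * (1 : Finset ι → ℝ) S.2) - fun S => (1 : Finset ι → ℝ) S.1 * F S.2)) (by
    rintro ⟨A, B⟩
    simp only [Pi.smul_apply, Pi.sub_apply, Pi.one_apply, smul_eq_mul, one_mul, mul_one]
    by_cases hA : 2 * w ≤ A.card
    · by_cases hB : 2 * w ≤ B.card
      · refine le_trans ?_ (hyes A B hA hB)
        exact mul_le_of_le_one_right (by positivity) (by linarith [hF0 A, hF0 B])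
      · refine le_trans ?_ (h0 _)
        exact mul_nonpos_of_nonneg_of_nonpos (by positivity) (by linarith [hF0 A, hF1 B hB])
    · refine le_trans ?_ (h0 _)
      exact mul_nonpos_of_nonneg_of_nonpos (by positivity) (by linarith [hF0 B, hF1 A hA]))
  have h2 := pow_mul_sum_half_pow_le (ι := ι) hw (by norm_num : (0 : ℝ) ≤ 4) (by norm_num) hu1 hu
  rw [map_smul, map_sub, map_sub, bernoulliMean_mul, bernoulliMean_mul, bernoulliMean_mul] at h1
  simp only [Pi.one_apply, mul_one, one_mul, sum_bernoulliWeight, smul_eq_mul] at h1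
  refine le_trans ?_ h1
  nlinarith

end MeanBounds

/-! ### Degree lower bound for separating polynomials -/

theorem exists_add_inv_eq {t : ℝ} (ht : 2 ≤ t) : ∃ s : ℝ, 1 ≤ s ∧ s + s⁻¹ = t := by
  have h := Real.sq_sqrt (show 0 ≤ t ^ 2 - 4 by nlinarith)
  have h0 := Real.sqrt_nonneg (t ^ 2 - 4)
  refine ⟨(t + √(t ^ 2 - 4)) / 2, by linarith, ?_⟩
  have : ((t + √(t ^ 2 - 4)) / 2)⁻¹ = (t - √(t ^ 2 - 4)) / 2 :=
    inv_eq_of_mul_eq_one_right (by nlinarith)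
  rw [this]
  ring

/-- A function of degree `d < w` on pairs of subsets of a set of `r * w` elements that separates
pairs of large sets from pairs with a small member has degree at least of the order of `√r`. -/
theorem le_sq_of_separates {ι : Type*} [Fintype ι] [DecidableEq ι] {w d : ℕ}
    {G : Finset ι × Finset ι → ℝ} {α r : ℝ} (hw : 1 ≤ w) (hdw : d < w)
    (hG : G ∈ pairPoly ℝ ι d) (hα : 0 < α) (h0 : ∀ S, 0 ≤ G S)
    (hno : ∀ A B, B.card < w → A.card < w ∨ 2 * w ≤ A.card → G (A, B) ≤ α ∧ G (B, A) ≤ α)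
    (hyes : ∀ A B, 2 * w ≤ A.card → 2 * w ≤ B.card → 2 * α ≤ G (A, B))
    (hr : 153632 ≤ r) (hrw : (Fintype.card ι : ℝ) = r * w) :
    r ≤ 307136 * (d : ℝ) ^ 2 := by
  have hw' : (1 : ℝ) ≤ w := by exact_mod_cast hw
  have hr0 : 0 < r := by linarith
  obtain ⟨p, hp, hps⟩ := exists_polynomial_bernoulliMean hG (16 / r)
  have h2 : 3.98 * α ≤ p.eval 2 := by
    have h := hps 1 one_ne_zero
    rw [inv_one, mul_one, one_add_one_eq_two] at h
    have h3 := le_bernoulliMean_of_le_on_yes hw hα.le h0 hyes (u := 16 / r) (by positivity)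
      ((div_le_one hr0).2 (by linarith)) (by rw [hrw]; field_simp; rfl)
    rw [h]
    linarith
  -- The left end gives `s ≥ 4800`, hence the small mean `16w/s ≤ w/300`. The right end keeps the
  -- probability `16s/r` at most `1`.
  have hI : ∀ t ∈ Set.Icc (4801 : ℝ) (r / 16), 0 ≤ p.eval t ∧ p.eval t ≤ 2.1 * α := by
    rintro t ⟨ht1, ht2⟩
    obtain ⟨s, hs1, rfl⟩ := exists_add_inv_eq (show 2 ≤ t by linarith)
    have hs0 : 0 < s := by linarith
    have hsi0 : 0 < s⁻¹ := inv_pos.2 hs0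
    have hsi1 : s⁻¹ ≤ 1 := inv_le_one_of_one_le₀ hs1
    have hs : 4800 ≤ s := by linarith
    have hx0 : 0 < 16 / r := by positivity
    have hu1 : 16 / r * s ≤ 1 := by
      calc 16 / r * s ≤ 16 / r * (r / 16) := by gcongr; linarith
        _ = 1 := by field_simp
    have hv1 : 16 / r * s⁻¹ ≤ 1 := le_trans (by gcongr; linarith) hu1
    have hu : 16 * (w : ℝ) ≤ 16 / r * s * Fintype.card ι := by
      have : 16 / r * s * Fintype.card ι = 16 * w * s := by rw [hrw]; field_simp
      rw [this]
      exact le_mul_of_one_le_right (by positivity) hs1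
    have hv : 16 / r * s⁻¹ * Fintype.card ι ≤ w / 300 := by
      have : 16 / r * s⁻¹ * Fintype.card ι = 16 * w * s⁻¹ := by rw [hrw]; field_simp
      rw [this]
      have : s⁻¹ ≤ 4800⁻¹ := inv_anti₀ (by norm_num) hs
      calc 16 * w * s⁻¹ ≤ 16 * w * (4800⁻¹ : ℝ) := by gcongr
        _ = w / 300 := by ring
    rw [hps s hs0.ne', ← bernoulliMean_swap (16 / r * s)]
    have hu0 : 0 ≤ 16 / r * s := by positivity
    have hv0 : 0 ≤ 16 / r * s⁻¹ := by positivity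
    have e1 := bernoulliMean_le_of_le_on_no hw hdw hG hα.le h0
      (fun A B hB hA => (hno A B hB hA).1) hu0 hu1 hv0 hv1 hu hv
    have e2 := bernoulliMean_le_of_le_on_no hw hdw (swap_mem_pairPoly hG) hα.le (fun S => h0 _)
      (fun A B hB hA => (hno A B hB hA).2) hu0 hu1 hv0 hv1 hu hv
    have e3 := bernoulliMean_mono hu0 hu1 hv0 hv1 (f := 0) h0
    have e4 := bernoulliMean_mono hu0 hu1 hv0 hv1 (f := 0) (g := fun S => G S.swap)
      (fun S => h0 _)
    rw [map_zero] at e3 e4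
    constructor <;> linarith
  have key := eval_le_of_mem_Icc_zero hp (show (4801 : ℝ) < r / 16 by linarith)
    (by positivity) (show (2 : ℝ) ≤ 4801 by norm_num) hI
  -- An exponent below `1` would give `p(2) ≤ 1.05 (1 + e) α < 3.98α`. As `153632 = 32 * 4801`, the
  -- interval has length at least `r / 32`, whence `307136 = 32 * 2 * 4799`.
  have hE : (1 : ℝ) ≤ d ^ 2 * (2 * (4801 - 2) / (r / 16 - 4801)) := by
    by_contra! hlt
    have h3 := Real.exp_lt_exp.2 hlt
    have h4 := Real.exp_one_lt_d9
    nlinarith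
  rw [← mul_div_assoc, le_div_iff₀ (by linarith)] at hE
  linarith

/-! ### Application to query algorithms -/

theorem acceptProb_nonneg {N : ℕ} (Q : QueryAlgorithm N) (S : Finset (Fin N) × Finset (Fin N)) :
    0 ≤ Q.acceptProb S :=
  Finset.sum_nonneg fun _ _ => sq_nonneg _

theorem univ_mem_yes {N w : ℕ} (hw : 1 ≤ w) (hN : 2 * w ≤ N) :
    ((Finset.univ, Finset.univ) : Finset (Fin N) × Finset (Fin N)) ∈ (AND₂ (ApxCount N w)).yes := by
  have : (Finset.univ : Finset (Fin N)) ∈ (ApxCount N w).yes :=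
    ⟨⟨⟨0, by omega⟩, Finset.mem_univ _⟩, by simpa using hN⟩
  exact ⟨this, this⟩

/-- Without queries the acceptance probability is constant. This settles the range where `N / w` is
bounded. -/
theorem one_le_numQueries {N w : ℕ} (hw : 1 ≤ w) (hN : 2 * w ≤ N) (Q : QueryAlgorithm N)
    (hQ : Q.IsSBQP (AND₂ (ApxCount N w))) : 1 ≤ Q.numQueries := by
  obtain ⟨α, hα, hyes, hno⟩ := hQ
  by_contra! h
  have hr : Q.rounds = [] := List.eq_nil_of_length_eq_zero (Nat.lt_one_iff.1 h)
  have h1 := hyes _ (univ_mem_yes hw hN)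
  have hs : ({⟨0, by omega⟩} : Finset (Fin N)) ∈ (ApxCount N w).no :=
    ⟨Finset.singleton_nonempty _, by simpa using hw⟩
  have h2 := hno (_, _) ⟨⟨Or.inr hs, Or.inr hs⟩, Or.inl hs⟩
  simp only [QueryAlgorithm.acceptProb, QueryAlgorithm.finalState, hr, List.foldl_nil] at h1 h2
  linarith

/-- Random sets may be empty, which the promise excludes. Inserting a fixed element `a` in both sets
repairs this without raising the degree; it is why small means `|A| < w` rather than `|A| ≤ w`. -/
theorem div_le_sq_numQueries {N w : ℕ} (hw : 1 ≤ w) (Q : QueryAlgorithm N)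
    (hQ : Q.IsSBQP (AND₂ (ApxCount N w))) (hT : 2 * Q.numQueries < w)
    (hr : (153632 : ℝ) ≤ N / w) : (N : ℝ) / w ≤ 307136 * (2 * Q.numQueries : ℕ) ^ 2 := by
  obtain ⟨α, hα, hyes, hno⟩ := hQ
  have hN : 0 < N := by
    rcases Nat.eq_zero_or_pos N with rfl | h
    · norm_num at hr
    · exact h
  set a : Fin N := ⟨0, hN⟩
  have large : ∀ A : Finset (Fin N), 2 * w ≤ A.card → insert a A ∈ (ApxCount N w).yes :=
    fun A hA => ⟨Finset.insert_nonempty a A,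
      hA.trans (Finset.card_le_card (Finset.subset_insert a A))⟩
  have small : ∀ A : Finset (Fin N), A.card < w → insert a A ∈ (ApxCount N w).no :=
    fun A hA => ⟨Finset.insert_nonempty a A, (Finset.card_insert_le a A).trans hA⟩
  refine le_sq_of_separates hw hT (insert_mem_pairPoly (acceptProb_mem_pairPoly Q) a) hα
    (fun S => acceptProb_nonneg Q _) (fun A B hB hA => ?_)
    (fun A B hA hB => hyes _ ⟨large A hA, large B hB⟩) hr ?_
  · have hA' : insert a A ∈ (ApxCount N w).yes ∪ (ApxCount N w).no :=
      hA.elim (fun h => Or.inr (small A h)) (fun h => Or.inl (large A h))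
    exact ⟨hno _ ⟨⟨hA', Or.inr (small B hB)⟩, Or.inr (small B hB)⟩,
      hno _ ⟨⟨Or.inr (small B hB), hA'⟩, Or.inl (small B hB)⟩⟩
  · have : (w : ℝ) ≠ 0 := by
      have : w ≠ 0 := by omega
      exact_mod_cast this
    rw [Fintype.card_fin, div_mul_cancel₀ _ this]

end SBQPQuery

theorem theorem1p2 :
    ∃ c : ℝ, 0 < c ∧ ∀ N w : ℕ, 1 ≤ w → 2 * w ≤ N →
      ∀ Q : SBQPQuery.QueryAlgorithm N,
        Q.IsSBQP (SBQPQuery.AND₂ (SBQPQuery.ApxCount N w)) →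
          c * min (w : ℝ) (Real.sqrt ((N : ℝ) / (w : ℝ))) ≤ (Q.numQueries : ℝ) := by
  -- Degree `2T` gives `N/w ≤ 4 * 307136 * T²`, which is below `(1200 T)²`.
  refine ⟨1 / 1200, by norm_num, fun N w hw hN Q hQ => ?_⟩
  have hT : (1 : ℝ) ≤ Q.numQueries := by
    exact_mod_cast SBQPQuery.one_le_numQueries hw hN Q hQ
  by_cases hTw : 2 * Q.numQueries < w
  · have hsqrt : Real.sqrt ((N : ℝ) / w) ≤ 1200 * Q.numQueries := by
      refine Real.sqrt_le_iff.2 ⟨by positivity, ?_⟩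
      by_cases hr : (153632 : ℝ) ≤ N / w
      · have h := SBQPQuery.div_le_sq_numQueries hw Q hQ hTw hr
        push_cast at h
        nlinarith
      · nlinarith
    linarith [min_le_right (w : ℝ) (Real.sqrt ((N : ℝ) / w))]
  · have h : (w : ℝ) ≤ 2 * Q.numQueries := by
      exact_mod_cast not_lt.1 hTw
    linarith [min_le_left (w : ℝ) (Real.sqrt ((N : ℝ) / w))]
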